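/- Let $n>-1$ be real and let $g(z)=\sum_{k\ge 0}\frac{\eta_k}{k!}z^k$ be a formal power series with complex coefficients and $\eta_0=1$. For $d\ge 1$ define the index-$n$ Laguerre–Jensen polynomial of $g$ by $$K_{d,g}(z)=\sum_{k=0}^d \eta_k\,(n+d)_k\binom{d}{k}z^k,\qquad (x)_k=x(x-1)\cdots(x-k+1).$$ Say that $g$ is in $\mathcal{LP}I$ if it converges on all of $\mathbb{C}$ and $$g(z)=e^{-\sigma^2 z}\prod_{j=1}^{N}\Bigl(1-\frac{z}{\alpha_j^2}\Bigr)\qquad(z\in\mathbb{C})$$ for some $\sigma\ge 0$, some $N\in\{0,1,2,\dots\}\cup\{\infty\}$ and nonzero real numbers $\alpha_j$ with $\sum_{j=1}^{N}\alpha_j^{-2}<\infty$. Then $g$ is in $\mathcal{LP}I$ if and only if, for every $d\ge 1$, all complex roots of $K_{d,g}$ (if any) are positive real numbers. Moreover, whenever $g$ converges on all of $\mathbb{C}$ (in particular, whenever $g$ is in $\mathcal{LP}I$), $$\lim_{d\to\infty}K_{d,g}\Bigl(\frac{z}{d(n+d)}\Bigr)=g(z)$$ uniformly on compact subsets of $\mathbb{C}$.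 -/

import Mathlib

open Filter Topology

noncomputable section

/-- The class `LP I` of entire functions
`f z = exp (-σ² z) * ∏_{j < N} (1 - z / α_j²)` with `σ ≥ 0`, real nonzero `α_j`,
`∑ 1 / α_j² < ∞`, and finitely or infinitely many factors (`N = ∞` is allowed). -/
def LaguerrePolyaI : Set (ℂ → ℂ) :=
  {f | ∃ (σ : ℝ) (N : ℕ∞) (α : {j : ℕ // (j : ℕ∞) < N} → ℝ),
    0 ≤ σ ∧ (∀ j, α j ≠ 0) ∧ Summable (fun j => 1 / α j ^ 2) ∧
    ∀ z : ℂ, f z = Complex.exp (-(σ : ℂ) ^ 2 * z) * ∏' j, (1 - z / (α j : ℂ) ^ 2)}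

/-- The formal power series `g` converges on all of `ℂ`, with sum `f`. -/
def HasEntireSum (g : PowerSeries ℂ) (f : ℂ → ℂ) : Prop :=
  ∀ z : ℂ, HasSum (fun k : ℕ => PowerSeries.coeff k g * z ^ k) (f z)

/-- The formal power series `g` is (the Taylor series at `0` of) a function in `LP I`. -/
def InLPI (g : PowerSeries ℂ) : Prop :=
  ∃ f ∈ LaguerrePolyaI, HasEntireSum g f

/-- The coefficients `η_k` in `g = ∑ η_k / k! z ^ k`. -/
def expCoeff (g : PowerSeries ℂ) (k : ℕ) : ℂ :=
  (k.factorial : ℂ) * PowerSeries.coeff k g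

/-- The index `n` Laguerre–Jensen polynomial
`K_{d,g}(z) = ∑_{k ≤ d} η_k (n + d)_k (d choose k) z ^ k`,
where `(x)_k = x (x - 1) ⋯ (x - k + 1)` is the falling factorial. -/
def laguerreJensen (n : ℝ) (g : PowerSeries ℂ) (d : ℕ) : Polynomial ℂ :=
  ∑ k ∈ Finset.range (d + 1),
    Polynomial.C (expCoeff g k * (((descPochhammer ℝ k).eval (n + d) : ℝ) : ℂ) *
      (d.choose k : ℂ)) * Polynomial.X ^ k

/-- Every complex root of `p` is a positive real number. -/
def OnlyPositiveRoots (p : Polynomial ℂ) : Prop :=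
  ∀ z : ℂ, p.IsRoot z → ∃ x : ℝ, 0 < x ∧ z = (x : ℂ)

end

/-!
The roots of `K_{d,g}` are positive for `g = ∏ (1 - c z)` with finitely many `c ≥ 0`: reversing the
coefficients of `K_{d,g}` gives `g(L) z ^ d`, where `L = z D² + (n + 1) D` is the Laguerre
derivative, and each `1 - c L` maps polynomials with nonnegative roots to polynomials with
nonnegative roots. Functions in `LP I` are limits of such products with `∑ c` bounded, which makes
the coefficients converge, and positivity of the roots survives this limit.

Conversely, if all the `K_{d,g}` have positive roots, then `K_{d,g}(z / (d (n + d)))` is a product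
`∏ (1 - c z)` with `c ≥ 0` and `∑ c = -g'(0)` independent of `d`. In particular the `k`-th
coefficients are bounded by `(∑ c) ^ k / k!`, so `g` is entire and these polynomials converge to it.
Listing the `c` in decreasing order, the `i`-th one is at most `(∑ c) / i`; this is square summable,
so the products `∏ (1 - c z) e ^ (c z)` pass to the limit along an ultrafilter.
-/

namespace LaguerreJensen

open Polynomial
open scoped ComplexOrder ComplexConjugate

/-! ### Nonnegative roots and the Laguerre derivative -/

/-- Every complex root of `p` is a nonnegative real number, expressed through the partial order
of `ComplexOrder`. -/
def NonnegRoots (p : ℂ[X]) : Prop :=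
  ∀ z : ℂ, p.IsRoot z → 0 ≤ z

theorem one_div_sub_ofReal (z : ℂ) (r : ℝ) :
    1 / (z - r) = ((Complex.normSq (z - r))⁻¹ : ℝ) * conj z -
      ((Complex.normSq (z - r))⁻¹ * r : ℝ) := by
  rw [one_div, Complex.inv_def, map_sub, Complex.conj_ofReal]
  push_cast
  ring

theorem NonnegRoots.exists_derivative_eval_eq {p : ℂ[X]} (h : NonnegRoots p) {z : ℂ}
    (hz : ¬0 ≤ z) : ∃ a b : ℝ, 0 ≤ a ∧ 0 ≤ b ∧
      p.derivative.eval z = (a * conj z - b) * p.eval z := by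
  have hpz : p.eval z ≠ 0 := fun h0 => hz (h z h0)
  have hsum : ∃ a b : ℝ, 0 ≤ a ∧ 0 ≤ b ∧
      (p.roots.map fun r => 1 / (z - r)).sum = a * conj z - b := by
    refine Multiset.sum_induction (fun u => ∃ a b : ℝ, 0 ≤ a ∧ 0 ≤ b ∧ u = a * conj z - b) _
      ?_ ⟨0, 0, le_rfl, le_rfl, by simp⟩ ?_
    · rintro _ _ ⟨a, b, ha, hb, rfl⟩ ⟨a', b', ha', hb', rfl⟩
      exact ⟨a + a', b + b', add_nonneg ha ha', add_nonneg hb hb', by push_cast; ring⟩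
    · simp only [Multiset.mem_map, forall_exists_index, and_imp]
      rintro _ r hr rfl
      have hr0 : 0 ≤ r := h r (isRoot_of_mem_roots hr)
      lift r to ℝ using (Complex.nonneg_iff.1 hr0).2.symm
      have hw : 0 ≤ (Complex.normSq (z - r))⁻¹ := inv_nonneg.2 (Complex.normSq_nonneg _)
      exact ⟨_, _, hw, mul_nonneg hw (Complex.zero_le_real.1 hr0), one_div_sub_ofReal z r⟩
  obtain ⟨a, b, ha, hb, hab⟩ := hsum
  refine ⟨a, b, ha, hb, ?_⟩
  rw [← hab, ← (IsAlgClosed.splits p).eval_derivative_div_eval_of_ne_zero hpz,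
    div_mul_cancel₀ _ hpz]

theorem NonnegRoots.derivative {p : ℂ[X]} (h : NonnegRoots p) (hp : p.derivative ≠ 0) :
    NonnegRoots p.derivative := by
  intro z hz
  have hdeg : 0 < p.degree := by
    by_contra! hle
    exact hp (by rw [eq_C_of_degree_le_zero hle, derivative_C])
  have hmem := rootSet_derivative_subset_convexHull_rootSet hdeg
    ((mem_rootSet_of_ne hp).2 (by simpa using hz))
  refine convexHull_min (fun w hw => ?_) (convex_Ici (0 : ℂ)) hmem
  exact h w (by simpa using (mem_rootSet.1 hw).2)

/-- For `z` in the upper half-plane the first factor has argument in `[-π, -arg z]` and the second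
one in `(arg z - π, 0]`, so the argument of the product lies strictly between `-2π` and `0`. -/
theorem not_nonneg_mul_of_cones {z : ℂ} (hz : ¬0 ≤ z) {a b a' b' : ℝ} (ha : 0 ≤ a) (hb : 0 ≤ b)
    (ha' : 0 < a') (hb' : 0 ≤ b') (hne : (a * conj z - b : ℂ) ≠ 0) :
    ¬0 ≤ (a * conj z - b) * (a' - b' * z) := by
  obtain ⟨x, y⟩ := z
  simp only [Complex.nonneg_iff, Complex.mul_re, Complex.mul_im, Complex.sub_re, Complex.sub_im,
    Complex.ofReal_re, Complex.ofReal_im, Complex.conj_re, Complex.conj_im] at hz ⊢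
  replace hne : ¬(a * x - b = 0 ∧ a * y = 0) := fun hab =>
    hne (Complex.ext (by simpa using hab.1) (by simpa using hab.2))
  rintro ⟨hre, him⟩
  rcases eq_or_ne y 0 with rfl | hy
  · have hx : x < 0 := by by_contra! hx; exact hz ⟨hx, rfl⟩
    have hneg : a * x - b < 0 := lt_of_le_of_ne (by nlinarith) fun h => hne ⟨h, by simp⟩
    nlinarith [mul_nonneg hb' (neg_nonneg.2 hx.le)]
  · have hab : b * b' = a * a' := mul_right_cancel₀ hy (by linear_combination -him)
    have hsq : a' * ((a * x - b) ^ 2 + (a * y) ^ 2) ≤ 0 := by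
      have := mul_nonneg hb hre
      linear_combination this + (b * x - a * (x ^ 2 + y ^ 2)) * hab
    have hsq' : (a * x - b) ^ 2 + (a * y) ^ 2 ≤ 0 := nonpos_of_mul_nonpos_right hsq ha'
    exact hne ⟨by nlinarith, by nlinarith⟩

/-- The Laguerre derivative `D (z D + n) = z D² + (n + 1) D` on polynomials. -/
noncomputable def laguerreOp (n : ℝ) : Module.End ℂ ℂ[X] :=
  LinearMap.mulLeft ℂ X ∘ₗ Polynomial.derivative ∘ₗ Polynomial.derivative +
    ((n : ℂ) + 1) • Polynomial.derivative

theorem laguerreOp_apply (n : ℝ) (p : ℂ[X]) :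
    laguerreOp n p =
      X * derivative (derivative p) + C ((n : ℂ) + 1) * derivative p := by
  simp [laguerreOp, smul_eq_C_mul]

theorem NonnegRoots.sub_smul_laguerreOp {n : ℝ} (hn : -1 < n) {p : ℂ[X]} (h : NonnegRoots p)
    {c : ℝ} (hc : 0 ≤ c) : NonnegRoots (p - (c : ℂ) • laguerreOp n p) := by
  rcases eq_or_ne (Polynomial.derivative p) 0 with hp | hp
  · simpa [laguerreOp_apply, hp] using h
  intro z hroot
  by_contra hz
  obtain ⟨a, b, ha, hb, hp₁⟩ := h.exists_derivative_eval_eq hz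
  obtain ⟨a', b', ha', hb', hp₂⟩ := (h.derivative hp).exists_derivative_eval_eq hz
  have hpz : p.eval z ≠ 0 := fun h0 => hz (h z h0)
  have hone : (c : ℂ) *
      ((a * conj z - b) * ((n + 1 + a' * Complex.normSq z : ℝ) - b' * z)) = 1 := by
    have hroot' : p.eval z - c * (z * ((a' * conj z - b') * ((a * conj z - b) * p.eval z)) +
        (n + 1) * ((a * conj z - b) * p.eval z)) = 0 := by
      simpa [laguerreOp_apply, hp₁, hp₂, mul_add] using hroot
    refine mul_right_cancel₀ hpz ?_
    push_cast [← Complex.mul_conj]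
    linear_combination -hroot'
  refine not_nonneg_mul_of_cones hz (a' := n + 1 + a' * Complex.normSq z) ha hb
    (add_pos_of_pos_of_nonneg (by linarith) (mul_nonneg ha' (Complex.normSq_nonneg z))) hb'
    (fun h0 => by simp [h0] at hone) ?_
  rw [eq_inv_of_mul_eq_one_right hone, ← Complex.ofReal_inv]
  exact Complex.zero_le_real.2 (inv_nonneg.2 hc)

/-- The factor `(n + d)_k (d)_k` by which passing from a power series to its `d`-th Laguerre–Jensen
polynomial multiplies the coefficient of `z ^ k`. -/
noncomputable def laguerreWeight (n : ℝ) (d k : ℕ) : ℝ :=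
  (descPochhammer ℝ k).eval (n + d) * (descPochhammer ℝ k).eval (d : ℝ)

theorem laguerreWeight_zero (n : ℝ) (d : ℕ) : laguerreWeight n d 0 = 1 := by
  simp [laguerreWeight]

theorem laguerreWeight_succ (n : ℝ) (d k : ℕ) :
    laguerreWeight n d (k + 1) = laguerreWeight n d k * ((n + d - k) * (d - k)) := by
  simp only [laguerreWeight, descPochhammer_succ_eval]
  ring

theorem laguerreWeight_of_lt (n : ℝ) {d k : ℕ} (h : d < k) : laguerreWeight n d k = 0 := by
  rw [laguerreWeight, descPochhammer_eval_eq_descFactorial, Nat.descFactorial_of_lt h,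
    Nat.cast_zero, mul_zero]

theorem coeff_laguerreJensen (n : ℝ) (g : PowerSeries ℂ) (d k : ℕ) :
    (laguerreJensen n g d).coeff k = PowerSeries.coeff k g * laguerreWeight n d k := by
  simp only [laguerreJensen, finsetSum_coeff, coeff_C_mul, coeff_X_pow, mul_ite, mul_one, mul_zero,
    Finset.sum_ite_eq, Finset.mem_range, Nat.lt_succ_iff]
  split_ifs with h
  · rw [laguerreWeight, descPochhammer_eval_eq_descFactorial,
      Nat.descFactorial_eq_factorial_mul_choose, expCoeff]
    push_cast
    ring
  · rw [laguerreWeight_of_lt n (not_le.1 h), Complex.ofReal_zero, mul_zero]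

theorem coeff_zero_laguerreJensen (n : ℝ) (g : PowerSeries ℂ) (d : ℕ) :
    (laguerreJensen n g d).coeff 0 = PowerSeries.coeff 0 g := by
  simp [coeff_laguerreJensen, laguerreWeight_zero]

theorem natDegree_laguerreJensen_le (n : ℝ) (g : PowerSeries ℂ) (d : ℕ) :
    (laguerreJensen n g d).natDegree ≤ d := by
  refine natDegree_le_iff_coeff_eq_zero.2 fun k hk => ?_
  rw [coeff_laguerreJensen, laguerreWeight_of_lt n hk, Complex.ofReal_zero, mul_zero]

theorem laguerreOp_X_pow (n : ℝ) (m : ℕ) :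
    laguerreOp n (X ^ m) = C ((m : ℂ) * (n + m)) * X ^ (m - 1) := by
  rcases m with - | - | m
  · simp [laguerreOp_apply]
  · simp [laguerreOp_apply]
  · simp [laguerreOp_apply]
    ring

theorem laguerreOp_pow_X_pow (n : ℝ) (d k : ℕ) :
    (laguerreOp n ^ k) (X ^ d) = C (laguerreWeight n d k : ℂ) * X ^ (d - k) := by
  induction k with
  | zero => simp [laguerreWeight_zero]
  | succ k ih =>
    rw [pow_succ', Module.End.mul_apply, ih, ← smul_eq_C_mul, map_smul, laguerreOp_X_pow,
      smul_eq_C_mul, ← mul_assoc, ← C_mul, Nat.sub_sub, laguerreWeight_succ]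
    rcases le_or_gt k d with h | h
    · push_cast [h]
      ring_nf
    · simp [laguerreWeight_of_lt n h]

theorem aeval_laguerreOp_X_pow (n : ℝ) (p : ℂ[X]) (d : ℕ) :
    aeval (laguerreOp n) p (X ^ d) = reflect d (laguerreJensen n p d) := by
  induction p using Polynomial.induction_on' with
  | add p q hp hq =>
    have hadd : laguerreJensen n ((p + q : ℂ[X]) : PowerSeries ℂ) d =
        laguerreJensen n p d + laguerreJensen n q d := by
      ext k
      simp [coeff_laguerreJensen, add_mul]
    rw [map_add, LinearMap.add_apply, hp, hq, hadd, reflect_add]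
  | monomial k a =>
    have hmonomial : laguerreJensen n (monomial k a : ℂ[X]) d =
        C (a * laguerreWeight n d k) * X ^ k := by
      ext j
      rw [coeff_laguerreJensen, coeff_coe, coeff_C_mul_X_pow, coeff_monomial]
      split_ifs with h h' h' <;> simp_all
    rw [aeval_monomial, Module.End.mul_apply, laguerreOp_pow_X_pow, hmonomial,
      reflect_C_mul_X_pow, Module.algebraMap_end_apply, smul_eq_C_mul, ← mul_assoc, ← C_mul]
    rcases le_or_gt k d with h | h
    · rw [revAt_le h]
    · simp [laguerreWeight_of_lt n h]

/-! ### Jensen polynomials of finite products -/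

/-- The polynomial `∏_{c ∈ s} (1 - c z)`, that is, the polynomial with value `1` at `0` whose roots
are the inverses of the nonzero elements of `s`. -/
noncomputable def prodOneSub (s : Multiset ℝ) : ℂ[X] :=
  (s.map fun c : ℝ => 1 - C (c : ℂ) * X).prod

theorem prodOneSub_cons (c : ℝ) (s : Multiset ℝ) :
    prodOneSub (c ::ₘ s) = (1 - C (c : ℂ) * X) * prodOneSub s := by
  simp [prodOneSub]

theorem eval_prodOneSub (s : Multiset ℝ) (z : ℂ) :
    (prodOneSub s).eval z = (s.map fun c : ℝ => 1 - (c : ℂ) * z).prod := by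
  simp [prodOneSub, eval_multiset_prod]

theorem coeff_zero_prodOneSub (s : Multiset ℝ) : (prodOneSub s).coeff 0 = 1 := by
  simp [coeff_zero_eq_eval_zero, eval_prodOneSub]

theorem coeff_one_prodOneSub (s : Multiset ℝ) : (prodOneSub s).coeff 1 = -(s.sum : ℂ) := by
  induction s using Multiset.induction_on with
  | empty => simp [prodOneSub, coeff_one]
  | cons c s ih =>
    rw [prodOneSub_cons, mul_coeff_one, ih, coeff_zero_prodOneSub, Multiset.sum_cons]
    simp [coeff_one]

theorem norm_coeff_prodOneSub_le {s : Multiset ℝ} (hs : ∀ c ∈ s, 0 ≤ c) (k : ℕ) :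
    ‖(prodOneSub s).coeff k‖ ≤ s.sum ^ k / k.factorial := by
  induction s using Multiset.induction_on generalizing k with
  | empty => rcases k with - | k <;> simp [prodOneSub, coeff_one]
  | cons c s ih =>
    rcases k with - | k
    · simp [coeff_zero_prodOneSub]
    have hc : 0 ≤ c := hs c (Multiset.mem_cons_self c s)
    have hs' : ∀ x ∈ s, 0 ≤ x := fun x hx => hs x (Multiset.mem_cons_of_mem hx)
    have hsum : 0 ≤ s.sum := Multiset.sum_nonneg hs'
    have hcoeff : (prodOneSub (c ::ₘ s)).coeff (k + 1) =
        (prodOneSub s).coeff (k + 1) - c * (prodOneSub s).coeff k := by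
      rw [prodOneSub_cons, sub_mul, one_mul, mul_assoc, coeff_sub, coeff_C_mul, coeff_X_mul]
    have hbernoulli : s.sum ^ (k + 1) + (k + 1) * c * s.sum ^ k ≤ (c + s.sum) ^ (k + 1) := by
      have := pow_add_mul_le_add_pow hsum (b := c) (by positivity) (k + 1)
      rw [add_tsub_cancel_right, add_comm s.sum c] at this
      push_cast at this
      linarith
    calc ‖(prodOneSub (c ::ₘ s)).coeff (k + 1)‖
        ≤ ‖(prodOneSub s).coeff (k + 1)‖ + c * ‖(prodOneSub s).coeff k‖ := by
          rw [hcoeff]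
          refine (norm_sub_le _ _).trans_eq ?_
          rw [norm_mul, Complex.norm_real, Real.norm_of_nonneg hc]
      _ ≤ s.sum ^ (k + 1) / (k + 1).factorial + c * (s.sum ^ k / k.factorial) := by
          gcongr
          · exact ih hs' (k + 1)
          · exact ih hs' k
      _ = (s.sum ^ (k + 1) + (k + 1) * c * s.sum ^ k) / (k + 1).factorial := by
          rw [Nat.factorial_succ]
          push_cast
          field_simp
      _ ≤ (c ::ₘ s).sum ^ (k + 1) / (k + 1).factorial := by
          rw [Multiset.sum_cons]
          gcongr

theorem nonnegRoots_aeval_prodOneSub {n : ℝ} (hn : -1 < n) {s : Multiset ℝ}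
    (hs : ∀ c ∈ s, 0 ≤ c) (d : ℕ) :
    NonnegRoots (aeval (laguerreOp n) (prodOneSub s) (X ^ d)) := by
  induction s using Multiset.induction_on with
  | empty =>
    intro z hz
    have hz' : z ^ d = 0 := by simpa [prodOneSub] using hz
    exact (eq_zero_of_pow_eq_zero hz').ge
  | cons c s ih =>
    rw [prodOneSub_cons, map_mul, Module.End.mul_apply]
    simpa [Module.algebraMap_end_apply] using
      (ih fun x hx => hs x (Multiset.mem_cons_of_mem hx)).sub_smul_laguerreOp hn
        (hs c (Multiset.mem_cons_self c s))

theorem onlyPositiveRoots_iff {p : ℂ[X]} : OnlyPositiveRoots p ↔ ∀ z, p.IsRoot z → 0 < z :=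
  forall₂_congr fun _ _ =>
    ⟨fun ⟨_, hx, hz⟩ => hz ▸ Complex.zero_lt_real.2 hx, fun hz =>
      ⟨_, (Complex.pos_iff.1 hz).1, Complex.eq_re_of_ofReal_le hz.le⟩⟩

theorem onlyPositiveRoots_laguerreJensen_prodOneSub {n : ℝ} (hn : -1 < n) {s : Multiset ℝ}
    (hs : ∀ c ∈ s, 0 ≤ c) (d : ℕ) : OnlyPositiveRoots (laguerreJensen n (prodOneSub s) d) := by
  refine onlyPositiveRoots_iff.2 fun z hz => ?_
  have hz0 : z ≠ 0 := by
    rintro rfl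
    rw [IsRoot.def, ← coeff_zero_eq_eval_zero, coeff_zero_laguerreJensen, coeff_coe,
      coeff_zero_prodOneSub] at hz
    exact one_ne_zero hz
  have hinv : 0 ≤ z⁻¹ := by
    refine nonnegRoots_aeval_prodOneSub hn hs d z⁻¹ ?_
    rw [aeval_laguerreOp_X_pow]
    let _ : Invertible z := invertibleOfNonzero hz0
    exact (eval₂_reflect_eq_zero_iff (RingHom.id ℂ) z d _ (natDegree_laguerreJensen_le _ _ _)).2 hz
  exact inv_pos.1 (hinv.lt_of_ne (inv_ne_zero hz0).symm)

/-! ### Limits of entire power series and of polynomials with positive roots -/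

theorem _root_.HasEntireSum.hasFPowerSeriesAt {g : PowerSeries ℂ} {f : ℂ → ℂ}
    (h : HasEntireSum g f) :
    HasFPowerSeriesAt f
      (FormalMultilinearSeries.ofScalars ℂ fun k => PowerSeries.coeff k g) 0 := by
  refine hasFPowerSeriesAt_iff.2 (Eventually.of_forall fun z => ?_)
  simpa only [FormalMultilinearSeries.coeff_ofScalars, smul_eq_mul, mul_comm, zero_add] using h z

theorem _root_.HasEntireSum.unique {g h : PowerSeries ℂ} {f : ℂ → ℂ} (hg : HasEntireSum g f)
    (hh : HasEntireSum h f) : g = h :=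
  PowerSeries.ext <| congrFun <| FormalMultilinearSeries.ofScalars_series_injective ℂ ℂ <|
    hg.hasFPowerSeriesAt.eq_formalMultilinearSeries hh.hasFPowerSeriesAt

theorem _root_.HasEntireSum.summable_norm {g : PowerSeries ℂ} {f : ℂ → ℂ} (h : HasEntireSum g f)
    (R : ℝ) : Summable fun k => ‖PowerSeries.coeff k g‖ * R ^ k := by
  refine .of_norm ((h R).summable.norm.congr fun k => ?_)
  simp

theorem hasEntireSum_coe (p : ℂ[X]) : HasEntireSum p p.eval := by
  intro z
  simp only [coeff_coe, eval_eq_sum_range]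
  refine hasSum_sum_of_ne_finset_zero fun k hk => ?_
  rw [coeff_eq_zero_of_natDegree_lt (by simpa using hk), zero_mul]

theorem exists_hasEntireSum {g : PowerSeries ℂ} {B : ℕ → ℝ}
    (hg : ∀ k, ‖PowerSeries.coeff k g‖ ≤ B k) (hB : ∀ R : ℝ, Summable fun k => B k * R ^ k) :
    ∃ f, HasEntireSum g f := by
  refine ⟨fun z => ∑' k, PowerSeries.coeff k g * z ^ k, fun z => Summable.hasSum ?_⟩
  refine .of_norm_bounded (hB ‖z‖) fun k => ?_
  rw [norm_mul, norm_pow]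
  exact mul_le_mul_of_nonneg_right (hg k) (by positivity)

theorem summable_pow_div_factorial_mul_pow (T R : ℝ) :
    Summable fun k : ℕ => T ^ k / k.factorial * R ^ k := by
  simpa only [mul_pow, mul_div_right_comm] using Real.summable_pow_div_factorial (T * R)

section Limits

variable {ι : Type*} {F : Filter ι} {G : ι → PowerSeries ℂ} {P : ι → ℂ → ℂ}
  {g : PowerSeries ℂ} {f : ℂ → ℂ} {B : ℕ → ℝ}

theorem tendstoUniformlyOn_of_tendsto_coeff (hP : ∀ i, HasEntireSum (G i) (P i))
    (hf : HasEntireSum g f) (hG : ∀ i k, ‖PowerSeries.coeff k (G i)‖ ≤ B k)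
    (hB : ∀ R : ℝ, Summable fun k => B k * R ^ k)
    (hlim : ∀ k, Tendsto (fun i => PowerSeries.coeff k (G i)) F (𝓝 (PowerSeries.coeff k g)))
    {S : Set ℂ} (hS : Bornology.IsBounded S) : TendstoUniformlyOn P f F S := by
  obtain ⟨R, hR0, hR⟩ := hS.exists_pos_norm_le
  let e : ι → ℕ → ℝ := fun i k => ‖PowerSeries.coeff k g - PowerSeries.coeff k (G i)‖ * R ^ k
  have he : ∀ i k, ‖e i k‖ ≤ ‖PowerSeries.coeff k g‖ * R ^ k + B k * R ^ k := fun i k => by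
    rw [Real.norm_of_nonneg (by positivity), ← add_mul]
    exact mul_le_mul_of_nonneg_right ((norm_sub_le _ _).trans (add_le_add_right (hG i k) _))
      (by positivity)
  have hsum := (hf.summable_norm R).add (hB R)
  have hE : Tendsto (fun i => ∑' k, e i k) F (𝓝 0) := by
    have hzero : ∀ k, Tendsto (fun i => e i k) F (𝓝 0) := fun k => by
      simpa [e] using ((hlim k).const_sub (PowerSeries.coeff k g)).norm.mul_const (R ^ k)
    simpa using tendsto_tsum_of_dominated_convergence hsum hzero (Eventually.of_forall he)
  refine Metric.tendstoUniformlyOn_iff.2 fun ε hε => ?_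
  filter_upwards [hE.eventually (gt_mem_nhds hε)] with i hi z hz
  refine lt_of_le_of_lt ?_ hi
  rw [dist_eq_norm, ← ((hf z).sub (hP i z)).tsum_eq]
  refine tsum_of_norm_bounded (hsum.of_norm_bounded (he i)).hasSum fun k => ?_
  rw [← sub_mul, norm_mul, norm_pow]
  exact mul_le_mul_of_nonneg_left (pow_le_pow_left₀ (norm_nonneg z) (hR z hz) k) (norm_nonneg _)

theorem exists_tendsto_of_forall_mem_isCompact {X : Type*} [TopologicalSpace X]
    (U : Ultrafilter ι) {K : Set X} (hK : IsCompact K) {u : ι → X} (hu : ∀ i, u i ∈ K) :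
    ∃ a, Tendsto u U (𝓝 a) := by
  obtain ⟨a, -, ha⟩ := hK.ultrafilter_le_nhds' (U.map u)
    (Ultrafilter.mem_map.2 (Eventually.of_forall hu))
  exact ⟨a, ha⟩

/-- Along any ultrafilter the coefficients converge to those of some power series; by dominated
convergence that series also sums to `f`, hence it is `g`. -/
theorem tendsto_coeff_of_tendsto (hP : ∀ i, HasEntireSum (G i) (P i))
    (hf : HasEntireSum g f) (hG : ∀ i k, ‖PowerSeries.coeff k (G i)‖ ≤ B k)
    (hB : ∀ R : ℝ, Summable fun k => B k * R ^ k)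
    (hlim : ∀ z, Tendsto (fun i => P i z) F (𝓝 (f z))) (k : ℕ) :
    Tendsto (fun i => PowerSeries.coeff k (G i)) F (𝓝 (PowerSeries.coeff k g)) := by
  refine (tendsto_iff_ultrafilter _ _ _).2 fun U hU => ?_
  have hcoeff : ∀ k, ∃ a, Tendsto (fun i => PowerSeries.coeff k (G i)) U (𝓝 a) := fun k =>
    exists_tendsto_of_forall_mem_isCompact U (isCompact_closedBall 0 (B k)) fun i => by
      simpa using hG i k
  choose a ha using hcoeff
  have hmk : ∀ k, Tendsto (fun i => PowerSeries.coeff k (G i)) U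
      (𝓝 (PowerSeries.coeff k (PowerSeries.mk a))) := by simpa only [PowerSeries.coeff_mk] using ha
  obtain ⟨f', hf'⟩ := exists_hasEntireSum
    (fun k => le_of_tendsto' (hmk k).norm fun i => hG i k) hB
  have hff' : f' = f := funext fun z => tendsto_nhds_unique
    ((tendstoUniformlyOn_of_tendsto_coeff hP hf' hG hB hmk
      (Bornology.isBounded_singleton (x := z))).tendsto_at rfl) ((hlim z).mono_left hU)
  rw [hf.unique (hff' ▸ hf')]
  exact hmk k

end Limits

theorem exists_prodOneSub_eq {p : ℂ[X]} (h0 : p.coeff 0 = 1) (hp : OnlyPositiveRoots p) :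
    ∃ s : Multiset ℝ, (∀ c ∈ s, 0 ≤ c) ∧ s.card = p.natDegree ∧ prodOneSub s = p := by
  have hsplits := IsAlgClosed.splits p
  have hpos : ∀ r ∈ p.roots, 0 < r := fun r hr =>
    onlyPositiveRoots_iff.1 hp r (isRoot_of_mem_roots hr)
  have hinv : ∀ r ∈ p.roots, ((r⁻¹.re : ℝ) : ℂ) = r⁻¹ := fun r hr =>
    (Complex.eq_re_of_ofReal_le (inv_pos.2 (hpos r hr)).le).symm
  refine ⟨p.roots.map fun r => r⁻¹.re, fun c hc => ?_, ?_, Polynomial.funext fun z => ?_⟩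
  · obtain ⟨r, hr, rfl⟩ := Multiset.mem_map.1 hc
    exact (Complex.nonneg_iff.1 (inv_pos.2 (hpos r hr)).le).1
  · rw [Multiset.card_map, hsplits.natDegree_eq_card_roots]
  have heval0 : p.leadingCoeff * (p.roots.map fun r => 0 - r).prod = 1 := by
    rw [← hsplits.eval_eq_prod_roots, ← coeff_zero_eq_eval_zero, h0]
  calc (prodOneSub (p.roots.map fun r => r⁻¹.re)).eval z
      = (p.roots.map fun r => (z - r) / (0 - r)).prod := by
        rw [eval_prodOneSub, Multiset.map_map]
        refine congrArg _ (Multiset.map_congr rfl fun r hr => ?_)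
        have := (hpos r hr).ne'
        rw [Function.comp_apply, hinv r hr]
        field_simp
        ring
    _ = p.leadingCoeff * (p.roots.map fun r => z - r).prod /
          (p.leadingCoeff * (p.roots.map fun r => 0 - r).prod) := by
        rw [Multiset.prod_map_div, mul_div_mul_left _ _ (left_ne_zero_of_mul_eq_one heval0)]
    _ = p.eval z := by rw [heval0, div_one, hsplits.eval_eq_prod_roots]

theorem exists_pos_le_norm_one_sub_mul {z : ℂ} (hz : ¬0 < z) :
    ∃ κ : ℝ, 0 < κ ∧ ∀ t : ℝ, 0 ≤ t → κ ≤ ‖1 - t * z‖ := by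
  rcases eq_or_ne z.im 0 with him | him
  · have hre : z.re ≤ 0 := by
      by_contra! hre
      exact hz (Complex.pos_iff.2 ⟨hre, him.symm⟩)
    refine ⟨1, one_pos, fun t ht => le_trans ?_ (Complex.re_le_norm _)⟩
    simpa using mul_nonpos_of_nonneg_of_nonpos ht hre
  · have hnorm : 0 < ‖z‖ := norm_pos_iff.2 fun h => him (by simp [h])
    refine ⟨|z.im| / ‖z‖, by positivity, fun t _ => (div_le_iff₀ hnorm).2 ?_⟩
    have him' : (conj z * (1 - t * z)).im = -z.im := by
      simp
      ring
    calc |z.im| = |(conj z * (1 - t * z)).im| := by rw [him', abs_neg]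
      _ ≤ ‖conj z * (1 - t * z)‖ := Complex.abs_im_le_norm _
      _ = ‖1 - t * z‖ * ‖z‖ := by rw [norm_mul, Complex.norm_conj, mul_comm]

theorem pow_card_le_norm_eval_prodOneSub {z : ℂ} {κ : ℝ} (hκ : 0 ≤ κ)
    (h : ∀ t : ℝ, 0 ≤ t → κ ≤ ‖1 - t * z‖) {s : Multiset ℝ} (hs : ∀ c ∈ s, 0 ≤ c) :
    κ ^ s.card ≤ ‖(prodOneSub s).eval z‖ := by
  calc κ ^ s.card = (s.map fun _ => κ).prod := by simp
    _ ≤ (s.map fun c : ℝ => ‖1 - (c : ℂ) * z‖).prod :=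
        Multiset.prod_map_le_prod_map₀ _ _ (fun _ _ => hκ) fun c hc => h c (hs c hc)
    _ = ‖(prodOneSub s).eval z‖ := by
        rw [eval_prodOneSub]
        exact Multiset.prod_hom' s (normHom : ℂ →*₀ ℝ) _

theorem onlyPositiveRoots_of_tendsto {ι : Type*} {F : Filter ι} [F.NeBot] {P : ι → ℂ[X]}
    {p : ℂ[X]} {d : ℕ} (hP0 : ∀ i, (P i).coeff 0 = 1) (hPd : ∀ i, (P i).natDegree ≤ d)
    (hP : ∀ i, OnlyPositiveRoots (P i))
    (hlim : ∀ k, Tendsto (fun i => (P i).coeff k) F (𝓝 (p.coeff k))) : OnlyPositiveRoots p := by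
  refine onlyPositiveRoots_iff.2 fun z hz => ?_
  by_contra hneg
  obtain ⟨κ, hκ, hle⟩ := exists_pos_le_norm_one_sub_mul hneg
  have hpd : p.natDegree ≤ d := natDegree_le_iff_coeff_eq_zero.2 fun k hk => by
    refine tendsto_nhds_unique (hlim k) (tendsto_const_nhds.congr fun i => ?_)
    rw [coeff_eq_zero_of_natDegree_lt ((hPd i).trans_lt hk)]
  have heval : Tendsto (fun i => (P i).eval z) F (𝓝 (p.eval z)) := by
    simp_rw [eval_eq_sum_range' (Nat.lt_succ_of_le (hPd _)),
      eval_eq_sum_range' (Nat.lt_succ_of_le hpd)]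
    exact tendsto_finsetSum _ fun k _ => (hlim k).mul_const _
  have hκ1 : κ ≤ 1 := by simpa using hle 0 le_rfl
  have hbound : ∀ i, κ ^ d ≤ ‖(P i).eval z‖ := fun i => by
    obtain ⟨s, hs, hcard, hsP⟩ := exists_prodOneSub_eq (hP0 i) (hP i)
    calc κ ^ d ≤ κ ^ s.card := pow_le_pow_of_le_one hκ.le hκ1 (hcard.trans_le (hPd i))
      _ ≤ ‖(P i).eval z‖ := hsP ▸ pow_card_le_norm_eval_prodOneSub hκ.le hle hs
  have := ge_of_tendsto' heval.norm hbound
  rw [hz.eq_zero, norm_zero] at this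
  exact (pow_pos hκ d).not_ge this

/-! ### Rescaled Laguerre–Jensen polynomials -/

/-- The weight of the coefficient of `z ^ k` relative to its scale `(d (n + d)) ^ k`; it tends to
`1` as `d → ∞`. -/
noncomputable def laguerreRatio (n : ℝ) (d k : ℕ) : ℝ :=
  laguerreWeight n d k / (d * (n + d)) ^ k

theorem laguerreRatio_zero (n : ℝ) (d : ℕ) : laguerreRatio n d 0 = 1 := by
  simp [laguerreRatio, laguerreWeight_zero]

theorem laguerreRatio_succ (n : ℝ) (d k : ℕ) :
    laguerreRatio n d (k + 1) = laguerreRatio n d k * ((n + d - k) * (d - k) / (d * (n + d))) := by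
  rw [laguerreRatio, laguerreWeight_succ, pow_succ, mul_div_mul_comm, laguerreRatio]

theorem natCast_mul_add_natCast_pos {n : ℝ} (hn : -1 < n) {d : ℕ} (hd : 1 ≤ d) :
    0 < (d : ℝ) * (n + d) := by
  have : (1 : ℝ) ≤ d := Nat.one_le_cast.2 hd
  exact mul_pos (by linarith) (by linarith)

theorem laguerreRatio_one {n : ℝ} (hn : -1 < n) {d : ℕ} (hd : 1 ≤ d) :
    laguerreRatio n d 1 = 1 := by
  rw [laguerreRatio_succ, laguerreRatio_zero, one_mul, Nat.cast_zero, sub_zero, sub_zero,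
    mul_comm, div_self (natCast_mul_add_natCast_pos hn hd).ne']

theorem laguerreRatio_mem_Icc {n : ℝ} (hn : -1 < n) (d k : ℕ) :
    laguerreRatio n d k ∈ Set.Icc 0 1 := by
  induction k with
  | zero => simp [laguerreRatio_zero]
  | succ k ih =>
    rcases le_or_gt d k with hdk | hdk
    · simp [laguerreRatio, laguerreWeight_of_lt n (Nat.lt_succ_of_le hdk)]
    have : (0 : ℝ) ≤ k := k.cast_nonneg
    have hkd : (k : ℝ) + 1 ≤ d := by exact_mod_cast hdk
    have hpos := natCast_mul_add_natCast_pos hn (Nat.one_le_of_lt hdk)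
    rw [laguerreRatio_succ]
    refine ⟨mul_nonneg ih.1 (div_nonneg (mul_nonneg ?_ ?_) hpos.le),
      mul_le_one₀ ih.2 (div_nonneg (mul_nonneg ?_ ?_) hpos.le) ((div_le_one hpos).2 ?_)⟩
    any_goals linarith
    rw [mul_comm]
    exact mul_le_mul (by linarith) (by linarith) (by linarith) (by linarith)

theorem tendsto_laguerreRatio (n : ℝ) (k : ℕ) :
    Tendsto (fun d => laguerreRatio n d k) atTop (𝓝 1) := by
  induction k with
  | zero => simp [laguerreRatio_zero]
  | succ k ih =>
    have hd : Tendsto (fun d : ℕ => (d : ℝ)) atTop atTop := tendsto_natCast_atTop_atTop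
    have hnd : Tendsto (fun d : ℕ => n + (d : ℝ)) atTop atTop :=
      tendsto_atTop_add_const_left _ _ hd
    have hfactors : Tendsto (fun d : ℕ => (1 - k / (n + d)) * (1 - (k : ℝ) / d)) atTop (𝓝 1) := by
      simpa using ((tendsto_const_nhds.div_atTop hnd).const_sub 1).mul
        ((tendsto_const_nhds.div_atTop hd).const_sub 1)
    rw [← mul_one (1 : ℝ)]
    refine (ih.mul hfactors).congr' ?_
    filter_upwards [hd.eventually_gt_atTop 0, hnd.eventually_gt_atTop 0] with d hd hnd
    rw [laguerreRatio_succ, one_sub_div hnd.ne', one_sub_div hd.ne', div_mul_div_comm,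
      mul_comm (n + (d : ℝ))]

/-- The rescaled Laguerre–Jensen polynomial `K_{d,g}(z / (d (n + d)))`. -/
noncomputable def scaledLaguerreJensen (n : ℝ) (g : PowerSeries ℂ) (d : ℕ) : ℂ[X] :=
  (laguerreJensen n g d).comp (C ((d : ℂ) * (n + d))⁻¹ * X)

theorem coeff_scaledLaguerreJensen (n : ℝ) (g : PowerSeries ℂ) (d k : ℕ) :
    (scaledLaguerreJensen n g d).coeff k = PowerSeries.coeff k g * laguerreRatio n d k := by
  rw [scaledLaguerreJensen, comp_C_mul_X_coeff, coeff_laguerreJensen, laguerreRatio]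
  push_cast
  rw [inv_pow, mul_assoc, div_eq_mul_inv]

theorem eval_scaledLaguerreJensen (n : ℝ) (g : PowerSeries ℂ) (d : ℕ) (z : ℂ) :
    (scaledLaguerreJensen n g d).eval z =
      (laguerreJensen n g d).eval (z / ((d : ℂ) * ((n : ℂ) + (d : ℂ)))) := by
  rw [scaledLaguerreJensen, eval_comp, eval_C_mul, eval_X, div_eq_inv_mul]

theorem onlyPositiveRoots_scaledLaguerreJensen {n : ℝ} (hn : -1 < n) {g : PowerSeries ℂ} {d : ℕ}
    (hd : 1 ≤ d) (h : OnlyPositiveRoots (laguerreJensen n g d)) :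
    OnlyPositiveRoots (scaledLaguerreJensen n g d) := by
  refine onlyPositiveRoots_iff.2 fun z hz => ?_
  have hscale : 0 < (d : ℂ) * (n + d) := by exact_mod_cast natCast_mul_add_natCast_pos hn hd
  rw [IsRoot.def, eval_scaledLaguerreJensen] at hz
  have := mul_pos (onlyPositiveRoots_iff.1 h _ hz) hscale
  rwa [div_mul_cancel₀ _ hscale.ne'] at this

theorem tendsto_coeff_scaledLaguerreJensen (n : ℝ) (g : PowerSeries ℂ) (k : ℕ) :
    Tendsto (fun d => (scaledLaguerreJensen n g d).coeff k) atTop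
      (𝓝 (PowerSeries.coeff k g)) := by
  simp_rw [coeff_scaledLaguerreJensen]
  simpa using ((Complex.continuous_ofReal.tendsto 1).comp (tendsto_laguerreRatio n k)).const_mul
    (PowerSeries.coeff k g)

theorem tendstoUniformlyOn_scaledLaguerreJensen {n : ℝ} (hn : -1 < n) {g : PowerSeries ℂ}
    {f : ℂ → ℂ} (hf : HasEntireSum g f) {S : Set ℂ} (hS : Bornology.IsBounded S) :
    TendstoUniformlyOn (fun d => (scaledLaguerreJensen n g d).eval) f atTop S := by
  refine tendstoUniformlyOn_of_tendsto_coeff (fun d => hasEntireSum_coe _) hf (fun d k => ?_)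
    hf.summable_norm (fun k => ?_) hS
  · have hmem := laguerreRatio_mem_Icc hn d k
    rw [coeff_coe, coeff_scaledLaguerreJensen, norm_mul, Complex.norm_real,
      Real.norm_of_nonneg hmem.1]
    exact mul_le_of_le_one_right (norm_nonneg _) hmem.2
  · simpa only [coeff_coe] using tendsto_coeff_scaledLaguerreJensen n g k

/-! ### Limits of finite products and the class `LP I` -/

theorem prodOneSub_add (s t : Multiset ℝ) : prodOneSub (s + t) = prodOneSub s * prodOneSub t := by
  simp [prodOneSub]

theorem tendsto_eval_prodOneSub_replicate (τ : ℝ) (z : ℂ) :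
    Tendsto (fun m : ℕ => (prodOneSub (Multiset.replicate m (τ / m))).eval z) atTop
      (𝓝 (Complex.exp (-τ * z))) := by
  refine (Complex.tendsto_one_add_div_pow_exp (-τ * z)).congr fun m => ?_
  rw [eval_prodOneSub, Multiset.map_replicate, Multiset.prod_replicate]
  push_cast
  ring

theorem multipliable_one_sub_mul {ι : Type*} {c : ι → ℝ} (hc : Summable c) (z : ℂ) :
    Multipliable fun i => 1 - (c i : ℂ) * z := by
  have hsum : Summable fun i => -((c i : ℂ) * z) :=
    ((Complex.hasSum_ofReal.2 hc.hasSum).mul_right z).summable.neg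
  simpa only [← sub_eq_add_neg] using multipliable_one_add_of_summable hsum.norm

theorem tendsto_eval_prodOneSub_map {ι : Type*} {c : ι → ℝ} (hc : Summable c) (z : ℂ) :
    Tendsto (fun u : Finset ι => (prodOneSub (u.val.map c)).eval z) atTop
      (𝓝 (∏' i, (1 - (c i : ℂ) * z))) := by
  refine Tendsto.congr (fun u => ?_) (multipliable_one_sub_mul hc z).hasProd
  rw [eval_prodOneSub, Multiset.map_map]
  rfl

theorem exists_tendsto_eval_prodOneSub {f : ℂ → ℂ} (hf : f ∈ LaguerrePolyaI) :
    ∃ (s : ℕ → Multiset ℝ) (T : ℝ), (∀ m, ∀ c ∈ s m, 0 ≤ c) ∧ (∀ m, (s m).sum ≤ T) ∧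
      ∀ z, Tendsto (fun m => (prodOneSub (s m)).eval z) atTop (𝓝 (f z)) := by
  obtain ⟨σ, N, α, -, -, hα, hf⟩ := hf
  obtain ⟨u, hu⟩ :=
    (atTop : Filter (Finset {j : ℕ // (j : ℕ∞) < N})).exists_seq_tendsto
  refine ⟨fun m => Multiset.replicate m (σ ^ 2 / m) + (u m).val.map fun j => 1 / α j ^ 2,
    σ ^ 2 + ∑' j, 1 / α j ^ 2, fun m c hc => ?_, fun m => ?_, fun z => ?_⟩
  · rcases Multiset.mem_add.1 hc with hc | hc
    · rw [Multiset.eq_of_mem_replicate hc]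
      positivity
    · obtain ⟨j, -, rfl⟩ := Multiset.mem_map.1 hc
      positivity
  · rw [Multiset.sum_add, Multiset.sum_replicate, nsmul_eq_mul,
      mul_div_left_comm]
    exact add_le_add (mul_le_of_le_one_right (sq_nonneg σ) (div_self_le_one _))
      (hα.sum_le_tsum (u m) fun j _ => by positivity)
  · have hlim := (tendsto_eval_prodOneSub_replicate (σ ^ 2) z).mul
      ((tendsto_eval_prodOneSub_map hα z).comp hu)
    rw [hf z]
    simpa [prodOneSub_add, div_eq_inv_mul] using hlim

/-- The elements of `s` in decreasing order, followed by zeros. -/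
noncomputable def decreasingEnum (s : Multiset ℝ) (i : ℕ) : ℝ :=
  (s.sort (· ≥ ·)).getD i 0

theorem decreasingEnum_nonneg {s : Multiset ℝ} (hs : ∀ c ∈ s, 0 ≤ c) (i : ℕ) :
    0 ≤ decreasingEnum s i := by
  rw [decreasingEnum]
  rcases lt_or_ge i (s.sort (· ≥ ·)).length with hi | hi
  · rw [List.getD_eq_getElem _ _ hi]
    exact hs _ ((Multiset.mem_sort _).1 (List.getElem_mem hi))
  · rw [List.getD_eq_default _ _ hi]

theorem antitone_decreasingEnum {s : Multiset ℝ} (hs : ∀ c ∈ s, 0 ≤ c) :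
    Antitone (decreasingEnum s) := by
  intro i j hij
  rcases lt_or_ge j (s.sort (· ≥ ·)).length with hj | hj
  · rw [decreasingEnum, decreasingEnum, List.getD_eq_getElem _ _ hj,
      List.getD_eq_getElem _ _ (hij.trans_lt hj)]
    exact (Multiset.pairwise_sort s (· ≥ ·)).rel_get_of_le hij
  · rw [decreasingEnum, List.getD_eq_default _ _ hj]
    exact decreasingEnum_nonneg hs i

@[to_additive]
theorem hasProd_comp_decreasingEnum {M : Type*} [CommMonoid M] [TopologicalSpace M]
    (s : Multiset ℝ) {φ : ℝ → M} (hφ : φ 0 = 1) :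
    HasProd (fun i => φ (decreasingEnum s i)) (s.map φ).prod := by
  have hprod : (s.map φ).prod =
      ∏ i ∈ Finset.range (s.sort (· ≥ ·)).length, φ (decreasingEnum s i) := by
    conv_lhs => rw [← s.sort_eq (· ≥ ·), Multiset.map_coe, Multiset.prod_coe,
      ← Fin.prod_univ_fun_getElem]
    rw [Finset.prod_range]
    exact Finset.prod_congr rfl fun i _ => by rw [decreasingEnum, List.getD_eq_getElem _ _ i.2]
  rw [hprod]
  refine hasProd_prod_of_ne_finset_one fun i hi => ?_
  rw [decreasingEnum, List.getD_eq_default _ _ (by simpa using hi), hφ]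

theorem hasSum_decreasingEnum (s : Multiset ℝ) : HasSum (decreasingEnum s) s.sum := by
  simpa using hasSum_comp_decreasingEnum s (φ := id) rfl

theorem le_div_succ_of_antitone_of_hasSum {β : ℕ → ℝ} (hanti : Antitone β) (hβ : ∀ i, 0 ≤ β i)
    {S : ℝ} (h : HasSum β S) (i : ℕ) : β i ≤ S / (i + 1) := by
  rw [le_div_iff₀ (by positivity)]
  calc β i * (i + 1) = ∑ _j ∈ Finset.range (i + 1), β i := by simp [mul_comm]
    _ ≤ ∑ j ∈ Finset.range (i + 1), β j := Finset.sum_le_sum fun j hj =>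
        hanti (Nat.lt_succ_iff.1 (Finset.mem_range.1 hj))
    _ ≤ S := sum_le_hasSum _ (fun j _ => hβ j) h

theorem decreasingEnum_le {s : Multiset ℝ} (hs : ∀ c ∈ s, 0 ≤ c) (i : ℕ) :
    decreasingEnum s i ≤ s.sum / (i + 1) :=
  le_div_succ_of_antitone_of_hasSum (antitone_decreasingEnum hs) (decreasingEnum_nonneg hs)
    (hasSum_decreasingEnum s) i

/-- The Weierstrass elementary factor of genus one. -/
noncomputable def elementaryFactor (w : ℂ) : ℂ :=
  (1 - w) * Complex.exp w

theorem continuous_elementaryFactor : Continuous elementaryFactor := by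
  unfold elementaryFactor
  fun_prop

theorem norm_elementaryFactor_sub_one_le (w : ℂ) :
    ‖elementaryFactor w - 1‖ ≤ 2 * ‖w‖ ^ 2 * Real.exp ‖w‖ := by
  have h₁ := Complex.norm_exp_sub_sum_le_norm_mul_exp w 1
  have h₂ := Complex.norm_exp_sub_sum_le_norm_mul_exp w 2
  simp only [Finset.sum_range_succ, Finset.sum_range_zero, pow_zero, pow_one, Nat.factorial,
    Nat.cast_one, div_one, zero_add, mul_one] at h₁ h₂
  have hsplit : elementaryFactor w - 1 =
      (Complex.exp w - (1 + w)) - w * (Complex.exp w - 1) := by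
    rw [elementaryFactor]
    ring
  calc ‖elementaryFactor w - 1‖
      ≤ ‖Complex.exp w - (1 + w)‖ + ‖w‖ * ‖Complex.exp w - 1‖ := by
        rw [hsplit, ← norm_mul]
        exact norm_sub_le _ _
    _ ≤ ‖w‖ ^ 2 * Real.exp ‖w‖ + ‖w‖ * (‖w‖ * Real.exp ‖w‖) := by gcongr
    _ = 2 * ‖w‖ ^ 2 * Real.exp ‖w‖ := by ring

theorem tendsto_tprod_elementaryFactor {ι κ : Type*} {F : Filter ι} {β : ι → κ → ℝ} {b B : κ → ℝ}
    (hB : Summable fun k => B k ^ 2) (hβB : ∀ i k, |β i k| ≤ B k)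
    (hβ : ∀ k, Tendsto (fun i => β i k) F (𝓝 (b k))) (z : ℂ) :
    Tendsto (fun i => ∏' k, elementaryFactor (β i k * z)) F
      (𝓝 (∏' k, elementaryFactor (b k * z))) := by
  obtain ⟨C, hC⟩ : ∃ C, ∀ k, |B k| ≤ C :=
    ⟨_, fun k => Real.abs_le_sqrt (hB.le_tsum k fun _ _ => sq_nonneg _)⟩
  have hnorm : ∀ i k, ‖elementaryFactor (β i k * z) - 1‖ ≤
      B k ^ 2 * (2 * ‖z‖ ^ 2 * Real.exp (C * ‖z‖)) := fun i k => by
    have hle : ‖(β i k : ℂ) * z‖ ≤ B k * ‖z‖ := by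
      rw [norm_mul, Complex.norm_real]
      exact mul_le_mul_of_nonneg_right (hβB i k) (norm_nonneg z)
    have hBC : B k ≤ C := (le_abs_self _).trans (hC k)
    calc ‖elementaryFactor (β i k * z) - 1‖
        ≤ 2 * ‖(β i k : ℂ) * z‖ ^ 2 * Real.exp ‖(β i k : ℂ) * z‖ :=
          norm_elementaryFactor_sub_one_le _
      _ ≤ 2 * (B k * ‖z‖) ^ 2 * Real.exp (C * ‖z‖) := by
          gcongr
          exact hle.trans (mul_le_mul_of_nonneg_right hBC (norm_nonneg z))
      _ = B k ^ 2 * (2 * ‖z‖ ^ 2 * Real.exp (C * ‖z‖)) := by ring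
  have hterm : ∀ k, Tendsto (fun i => elementaryFactor (β i k * z) - 1) F
      (𝓝 (elementaryFactor (b k * z) - 1)) := fun k =>
    ((continuous_elementaryFactor.tendsto _).comp
      (((Complex.continuous_ofReal.tendsto _).comp (hβ k)).mul_const z)).sub_const 1
  simpa only [add_sub_cancel] using tendsto_tprod_one_add_of_dominated_convergence
    (hB.mul_right _) hterm (Eventually.of_forall hnorm)

theorem tprod_elementaryFactor {κ : Type*} {b : κ → ℝ} (hb : Summable b) (z : ℂ) :
    ∏' k, elementaryFactor (b k * z) =
      (∏' k, (1 - (b k : ℂ) * z)) * Complex.exp ((∑' k, b k : ℝ) * z) :=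
  ((multipliable_one_sub_mul hb z).hasProd.mul
    ((Complex.hasSum_ofReal.2 hb.hasSum).mul_right z).cexp).tprod_eq

theorem tprod_elementaryFactor_decreasingEnum (s : Multiset ℝ) (z : ℂ) :
    ∏' k, elementaryFactor (decreasingEnum s k * z) =
      (prodOneSub s).eval z * Complex.exp (s.sum * z) := by
  have hexp : Complex.exp (s.sum * z) = (s.map fun c : ℝ => Complex.exp (c * z)).prod := by
    rw [← Complex.ofRealHom_eq_coe, map_multiset_sum, ← Multiset.sum_map_mul_right,
      Complex.exp_multiset_sum]
    simp
  rw [hexp, eval_prodOneSub, ← Multiset.prod_map_mul]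
  exact (hasProd_comp_decreasingEnum s (φ := fun c => elementaryFactor (c * z))
    (by simp [elementaryFactor])).tprod_eq

theorem exists_enat_lt_iff_of_antitone {p : ℕ → Prop} (hp : Antitone p) :
    ∃ N : ℕ∞, ∀ j : ℕ, (j : ℕ∞) < N ↔ p j := by
  classical
  by_cases h : ∃ j, ¬p j
  · refine ⟨(Nat.find h : ℕ), fun j => ?_⟩
    rw [Nat.cast_lt, Nat.lt_find_iff]
    exact ⟨fun hj => not_not.1 (hj j le_rfl), fun hj m hm => not_not.2 (hp hm hj)⟩
  · exact ⟨⊤, fun j => by simpa using not_exists_not.1 h j⟩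

theorem mem_laguerrePolyaI_of_antitone {b : ℕ → ℝ} (hanti : Antitone b) (hb : ∀ i, 0 ≤ b i)
    (hsum : Summable b) {τ : ℝ} (hτ : 0 ≤ τ) :
    (fun z : ℂ => Complex.exp (-τ * z) * ∏' i, (1 - (b i : ℂ) * z)) ∈ LaguerrePolyaI := by
  obtain ⟨N, hN⟩ := exists_enat_lt_iff_of_antitone (p := fun j => 0 < b j)
    fun _ _ hij h => h.trans_le (hanti hij)
  have hinv : ∀ j, 1 / (√(b j))⁻¹ ^ 2 = b j := fun j => by
    rw [inv_pow, Real.sq_sqrt (hb j), one_div, inv_inv]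
  refine ⟨√τ, N, fun j => (√(b j))⁻¹, Real.sqrt_nonneg _, fun j => ?_, ?_, fun z => ?_⟩
  · exact inv_ne_zero (Real.sqrt_pos.2 ((hN j).1 j.2)).ne'
  · simp_rw [hinv]
    exact hsum.subtype {j : ℕ | (j : ℕ∞) < N}
  · have hfactor : ∀ j : ℕ, 1 - z / (((√(b j))⁻¹ : ℝ) : ℂ) ^ 2 = 1 - b j * z := fun j => by
      rw [← Complex.ofReal_pow, div_eq_mul_one_div, ← Complex.ofReal_one, ← Complex.ofReal_div,
        hinv, mul_comm]
    simp_rw [hfactor]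
    rw [← Complex.ofReal_pow, Real.sq_sqrt hτ]
    congr 1
    refine (tprod_subtype_eq_of_mulSupport_subset (f := fun i => 1 - (b i : ℂ) * z)
      (s := {j : ℕ | (j : ℕ∞) < N}) fun j hj => (hN j).2 ((hb j).lt_of_ne fun h0 => hj ?_)).symm
    simp [← h0]

section Limits

variable {ι : Type*} {s : ι → Multiset ℝ} {T : ℝ}

theorem exists_tendsto_decreasingEnum (hs : ∀ i, ∀ c ∈ s i, 0 ≤ c) (hT : ∀ i, (s i).sum ≤ T)
    (U : Ultrafilter ι) :
    ∃ (b : ℕ → ℝ) (τ : ℝ), (∀ k, Tendsto (fun i => decreasingEnum (s i) k) U (𝓝 (b k))) ∧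
      Tendsto (fun i => (s i).sum) U (𝓝 τ) ∧
      Antitone b ∧ (∀ k, 0 ≤ b k) ∧ Summable b ∧ ∑' k, b k ≤ τ := by
  have hb : ∀ k : ℕ, ∃ a, Tendsto (fun i => decreasingEnum (s i) k) U (𝓝 a) := fun k =>
    exists_tendsto_of_forall_mem_isCompact U (isCompact_Icc (a := 0) (b := T / (k + 1)))
      fun i => ⟨decreasingEnum_nonneg (hs i) k,
        (decreasingEnum_le (hs i) k).trans (by gcongr; exact hT i)⟩
  choose b hb using hb
  obtain ⟨τ, hτ⟩ := exists_tendsto_of_forall_mem_isCompact U (isCompact_Icc (a := 0) (b := T))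
    fun i => ⟨Multiset.sum_nonneg (hs i), hT i⟩
  have hb0 : ∀ k, 0 ≤ b k := fun k => ge_of_tendsto' (hb k) fun i =>
    decreasingEnum_nonneg (hs i) k
  have hpartial : ∀ u : Finset ℕ, ∑ k ∈ u, b k ≤ τ := fun u =>
    le_of_tendsto_of_tendsto' (tendsto_finsetSum u fun k _ => hb k) hτ fun i =>
      sum_le_hasSum u (fun k _ => decreasingEnum_nonneg (hs i) k) (hasSum_decreasingEnum (s i))
  have hsum := summable_of_sum_le hb0 hpartial
  exact ⟨b, τ, hb, hτ,
    fun _ _ hjk => le_of_tendsto_of_tendsto' (hb _) (hb _) fun i =>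
      antitone_decreasingEnum (hs i) hjk,
    hb0, hsum, hsum.tsum_le_of_sum_le hpartial⟩

theorem summable_div_succ_sq (T : ℝ) : Summable fun k : ℕ => (T / ((k : ℝ) + 1)) ^ 2 := by
  have := ((summable_nat_add_iff 1).2 (Real.summable_one_div_nat_pow.2 one_lt_two)).mul_left
    (T ^ 2)
  simpa [div_eq_mul_inv, mul_pow] using this

/-- Convergence factors keep the product under control when mass `∑ c` escapes to infinity:
`∏ (1 - c z) e ^ (c z)` passes to the limit, and the escaped mass reappears in the exponential. -/
theorem mem_laguerrePolyaI_of_tendsto {F : Filter ι} [F.NeBot] {f : ℂ → ℂ}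
    (hs : ∀ i, ∀ c ∈ s i, 0 ≤ c) (hT : ∀ i, (s i).sum ≤ T)
    (hf : ∀ z, Tendsto (fun i => (prodOneSub (s i)).eval z) F (𝓝 (f z))) :
    f ∈ LaguerrePolyaI := by
  let U := Ultrafilter.of F
  obtain ⟨b, τ, hb, hτ, hanti, hb0, hsum, hle⟩ := exists_tendsto_decreasingEnum hs hT U
  have hfactors : ∀ i k, |decreasingEnum (s i) k| ≤ T / ((k : ℝ) + 1) := fun i k => by
    rw [abs_of_nonneg (decreasingEnum_nonneg (hs i) k)]
    exact (decreasingEnum_le (hs i) k).trans (by gcongr; exact hT i)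
  have hlim : ∀ z : ℂ, f z * Complex.exp (τ * z) =
      (∏' k, (1 - (b k : ℂ) * z)) * Complex.exp ((∑' k, b k : ℝ) * z) := fun z => by
    have hprod := tendsto_tprod_elementaryFactor (summable_div_succ_sq T) hfactors hb z
    simp only [tprod_elementaryFactor_decreasingEnum, tprod_elementaryFactor hsum] at hprod
    have hexp : Tendsto (fun i => Complex.exp ((s i).sum * z)) U (𝓝 (Complex.exp (τ * z))) :=
      (((Complex.continuous_ofReal.tendsto τ).comp hτ).mul_const z).cexp
    exact tendsto_nhds_unique (((hf z).mono_left (Ultrafilter.of_le F)).mul hexp) hprod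
  have hfz : f = fun z => Complex.exp (-(τ - ∑' k, b k : ℝ) * z) * ∏' k, (1 - (b k : ℂ) * z) := by
    funext z
    rw [eq_div_of_mul_eq (Complex.exp_ne_zero _) (hlim z), mul_div_assoc, ← Complex.exp_sub,
      mul_comm]
    congr 2
    push_cast
    ring
  rw [hfz]
  exact mem_laguerrePolyaI_of_antitone hanti hb0 hsum (sub_nonneg.2 hle)

end Limits

theorem norm_coeff_prodOneSub_le_of_sum_le {s : Multiset ℝ} {T : ℝ} (hs : ∀ c ∈ s, 0 ≤ c)
    (hT : s.sum ≤ T) (k : ℕ) : ‖(prodOneSub s).coeff k‖ ≤ T ^ k / k.factorial := by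
  have := Multiset.sum_nonneg hs
  exact (norm_coeff_prodOneSub_le hs k).trans (by gcongr)

theorem onlyPositiveRoots_laguerreJensen_of_inLPI {n : ℝ} (hn : -1 < n) {g : PowerSeries ℂ}
    (hg : InLPI g) (d : ℕ) : OnlyPositiveRoots (laguerreJensen n g d) := by
  obtain ⟨f, hf, hgf⟩ := hg
  obtain ⟨s, T, hs, hT, hlim⟩ := exists_tendsto_eval_prodOneSub hf
  have hcoeff : ∀ k, Tendsto (fun m => (prodOneSub (s m)).coeff k) atTop
      (𝓝 (PowerSeries.coeff k g)) := fun k => by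
    simpa only [coeff_coe] using tendsto_coeff_of_tendsto (fun m => hasEntireSum_coe _) hgf
      (fun m k => (congrArg norm (coeff_coe _ k)).trans_le
        (norm_coeff_prodOneSub_le_of_sum_le (hs m) (hT m) k))
      (summable_pow_div_factorial_mul_pow T) hlim k
  refine onlyPositiveRoots_of_tendsto (F := atTop)
    (fun m => (coeff_zero_laguerreJensen n (prodOneSub (s m)) d).trans ?_)
    (fun m => natDegree_laguerreJensen_le n _ d)
    (fun m => onlyPositiveRoots_laguerreJensen_prodOneSub hn (hs m) d) fun k => ?_
  · rw [coeff_coe, coeff_zero_prodOneSub]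
  · simpa only [coeff_laguerreJensen, coeff_coe] using (hcoeff k).mul_const _

theorem inLPI_of_onlyPositiveRoots_laguerreJensen {n : ℝ} (hn : -1 < n) {g : PowerSeries ℂ}
    (hg : PowerSeries.coeff 0 g = 1)
    (h : ∀ d : ℕ, 1 ≤ d → OnlyPositiveRoots (laguerreJensen n g d)) : InLPI g := by
  have hfactor : ∀ d : ℕ, ∃ s : Multiset ℝ, (∀ c ∈ s, 0 ≤ c) ∧
      s.sum = -(PowerSeries.coeff 1 g).re ∧
      prodOneSub s = scaledLaguerreJensen n g (d + 1) := fun d => by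
    have hd := Nat.le_add_left 1 d
    obtain ⟨s, hs, -, hsg⟩ := exists_prodOneSub_eq
      (by rw [coeff_scaledLaguerreJensen, laguerreRatio_zero, hg]; simp)
      (onlyPositiveRoots_scaledLaguerreJensen hn hd (h _ hd))
    have hcoeff := coeff_one_prodOneSub s
    rw [hsg, coeff_scaledLaguerreJensen, laguerreRatio_one hn hd, Complex.ofReal_one,
      mul_one] at hcoeff
    exact ⟨s, hs, by simp [hcoeff], hsg⟩
  choose s hs hsum hsg using hfactor
  have hbound : ∀ k, ‖PowerSeries.coeff k g‖ ≤
      (-(PowerSeries.coeff 1 g).re) ^ k / k.factorial := fun k =>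
    le_of_tendsto' ((tendsto_coeff_scaledLaguerreJensen n g k).comp (tendsto_add_atTop_nat 1)).norm
      fun d => by
        rw [Function.comp_apply, ← hsg]
        exact norm_coeff_prodOneSub_le_of_sum_le (hs d) (hsum d).le k
  obtain ⟨f, hf⟩ := exists_hasEntireSum hbound (summable_pow_div_factorial_mul_pow _)
  refine ⟨f, mem_laguerrePolyaI_of_tendsto (F := atTop) hs (fun d => (hsum d).le) fun z => ?_, hf⟩
  simp only [hsg]
  exact ((tendstoUniformlyOn_scaledLaguerreJensen hn hf
    Bornology.isBounded_singleton).tendsto_at (Set.mem_singleton z)).comp (tendsto_add_atTop_nat 1)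

end LaguerreJensen

theorem mainTheorem11 (n : ℝ) (hn : -1 < n) (g : PowerSeries ℂ)
    (hg : PowerSeries.coeff 0 g = 1) :
    (InLPI g ↔ ∀ d : ℕ, 1 ≤ d → OnlyPositiveRoots (laguerreJensen n g d)) ∧
    ∀ f : ℂ → ℂ, HasEntireSum g f → ∀ S : Set ℂ, IsCompact S →
      TendstoUniformlyOn
        (fun (d : ℕ) (z : ℂ) =>
          (laguerreJensen n g d).eval (z / ((d : ℂ) * ((n : ℂ) + (d : ℂ)))))
        f atTop S := by
  refine ⟨⟨fun h d _ => LaguerreJensen.onlyPositiveRoots_laguerreJensen_of_inLPI hn h d,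
    LaguerreJensen.inLPI_of_onlyPositiveRoots_laguerreJensen hn hg⟩, fun f hf S hS => ?_⟩
  exact (LaguerreJensen.tendstoUniformlyOn_scaledLaguerreJensen hn hf hS.isBounded).congr
    (.of_forall fun d z _ => LaguerreJensen.eval_scaledLaguerreJensen n g d z)
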